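/- Let $\mathbb X\subseteq\mathbb R^d$ be open and convex (for instance $\mathbb X=\mathbb R^d$), let $f:\mathbb X\to\mathbb R$ be twice continuously differentiable, and let $(\alpha_k)_{k\in\mathbb N}$ be positive real numbers with $\alpha_k\to 0$ and $\alpha_k=\Omega(1/k)$, i.e. there are $c>0$ and $K\ge 1$ with $\alpha_k\ge c/k$ for all $k\ge K$. A strict saddle point of $f$ is a point $x^*\in\mathbb X$ with $\nabla f(x^*)=0$ and $\lambda_{\min}(\nabla^2 f(x^*))<0$. Consider the proximal point method, started at $x_0\in\mathbb X$, $$x_{k+1}\in\operatorname*{arg\,min}_{z\in\mathbb X}\Big\{f(z)+\frac{1}{2\alpha_k}\|x_k-z\|^2\Big\},\qquad k=0,1,2,\dots,$$ where $\|\cdot\|$ is the Euclidean norm. Then the stable set of the strict saddle points, that is, the set of all $x_0\in\mathbb X$ from which some sequence $(x_k)_{k\in\mathbb N}$ generated by the method exists and converges to a strict saddle point of $f$, has Lebesgue measure zero. (When the minimizers are unique, this is the set of all $x_0$ for which the sequence generated from $x_0$ exists and converges to a strict saddle point.) -/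

import Mathlib

open Filter Topology MeasureTheory Asymptotics

noncomputable section

/-- The Hessian of `f : ℝᵈ → ℝ` at `x`, as a linear operator: the derivative of the gradient. -/
def hessian {d : ℕ} (f : EuclideanSpace ℝ (Fin d) → ℝ) (x : EuclideanSpace ℝ (Fin d)) :
    EuclideanSpace ℝ (Fin d) →L[ℝ] EuclideanSpace ℝ (Fin d) :=
  fderiv ℝ (gradient f) x

/-- The set of strict saddle points of `f` on the open set `X`: the critical points in `X` at which
the smallest eigenvalue of the Hessian (equivalently, some eigenvalue) is negative. -/
def strictSaddles {d : ℕ} (f : EuclideanSpace ℝ (Fin d) → ℝ)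
    (X : Set (EuclideanSpace ℝ (Fin d))) : Set (EuclideanSpace ℝ (Fin d)) :=
  {p | p ∈ X ∧ gradient f p = 0 ∧
    ∃ μ : ℝ, μ < 0 ∧ Module.End.HasEigenvalue (hessian f p).toLinearMap μ}

/-- The set of minimizers over `z ∈ X` of `f z + ‖x - z‖² / (2 α)`. -/
def proxArgmin {d : ℕ} (f : EuclideanSpace ℝ (Fin d) → ℝ) (X : Set (EuclideanSpace ℝ (Fin d)))
    (α : ℝ) (x : EuclideanSpace ℝ (Fin d)) : Set (EuclideanSpace ℝ (Fin d)) :=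
  {y | y ∈ X ∧ IsMinOn (fun z => f z + 1 / (2 * α) * ‖x - z‖ ^ 2) X y}

/-- `x` is a run of the proximal point method with step sizes `α`: it starts in `X`, and each
`x (k + 1)` is a minimizer of `f z + ‖x k - z‖² / (2 α k)` over `z ∈ X`. -/
def IsProximalPointSequence {d : ℕ} (f : EuclideanSpace ℝ (Fin d) → ℝ)
    (X : Set (EuclideanSpace ℝ (Fin d))) (α : ℕ → ℝ) (x : ℕ → EuclideanSpace ℝ (Fin d)) : Prop :=
  x 0 ∈ X ∧ ∀ k, x (k + 1) ∈ proxArgmin f X (α k) (x k)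

/-- The global stable set of `A` for the proximal point method: the initial points from which
the method converges to a point of `A`. Where the minimizer is not unique, an initial point is
counted as soon as one choice of minimizers leads to a point of `A`. -/
def proximalStableSet {d : ℕ} (f : EuclideanSpace ℝ (Fin d) → ℝ)
    (X : Set (EuclideanSpace ℝ (Fin d))) (α : ℕ → ℝ) (A : Set (EuclideanSpace ℝ (Fin d))) :
    Set (EuclideanSpace ℝ (Fin d)) :=
  {x₀ | ∃ x : ℕ → EuclideanSpace ℝ (Fin d), x 0 = x₀ ∧ IsProximalPointSequence f X α x ∧
    ∃ p ∈ A, Tendsto x atTop (𝓝 p)}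

end

open scoped RealInnerProductSpace

section NormedSpace

variable {E : Type*} [NormedAddCommGroup E] [InnerProductSpace ℝ E]

/-! The optimality condition `x k = x (k + 1) + α k • ∇f (x (k + 1))` makes the step explicit
backwards in time, so neither uniqueness of minimizers nor an invertible step map is needed. Near a
saddle with Hessian `H`, put `S = H + δ`, injective and still negative in some direction `e`. If two
orbits that stay nearby have `⟪v, S v⟫ < 0` for their initial difference `v`, then `-⟪v, S v⟫` grows
at least by factors `1 + 2 δ α k` (`inner_shift_expansion`); this is unbounded since `∑ α k`
diverges. Hence differences of trapped starting points avoid a cone around `e`, and such a set is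
null (`addHaar_eq_zero_of_inner_sub_nonneg`). Countably many neighborhoods suffice, and the
differentiable backward steps carry null sets to null sets. -/

/-- Expansion estimate for a quadratic form along one implicit gradient step, up to an error `w`. -/
theorem inner_shift_expansion {H : E →L[ℝ] E} (hH : ∀ v w, ⟪H v, w⟫ = ⟪v, H w⟫)
    {δ C ε a : ℝ} {S : E →L[ℝ] E} (hS : ∀ v, S v = H v + δ • v) 
    (hSC : ∀ v, ‖v‖ ≤ C * ‖S v‖) (hε : 0 ≤ ε) (hεC : ε * C ≤ 1 / 2) (ha : 0 ≤ a)
    (haC : a * (‖S‖ * ((‖H‖ + ε) * C) ^ 2) ≤ 1) {u v w : E} (hw : ‖w‖ ≤ ε * ‖v‖)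
    (hu : u = v + a • (H v + w)) :
    (1 - 2 * a * δ) * ⟪v, S v⟫ ≤ ⟪u, S u⟫ := by
  have hSsymm : ∀ v w, ⟪S v, w⟫ = ⟪v, S w⟫ := fun v w => by
    simp only [hS, inner_add_left, inner_add_right, inner_smul_left, inner_smul_right, hH v w]
    simp
  set z := H v + w with hz
  have hexp : ⟪u, S u⟫ = ⟪v, S v⟫ + 2 * a * ⟪S v, z⟫ + a ^ 2 * ⟪z, S z⟫ := by
    have h1 : ⟪z, S v⟫ = ⟪S v, z⟫ := real_inner_comm _ _
    have h2 : ⟪v, S z⟫ = ⟪S v, z⟫ := (hSsymm v z).symm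
    rw [hu]
    simp only [map_add, map_smul, inner_add_left, inner_add_right, inner_smul_left,
      inner_smul_right, h1, h2]
    simp only [conj_trivial]
    ring
  -- The gain `2 * a * ‖S v‖ ^ 2` absorbs all errors: half pays for `w`, half for the term in `a ^
  -- 2`.
  have hlin : ⟪S v, z⟫ = ‖S v‖ ^ 2 - δ * ⟪v, S v⟫ + ⟪S v, w⟫ := by
    have : z = S v - δ • v + w := by rw [hS, hz]; abel
    rw [this, inner_add_right, inner_sub_right, inner_smul_right, real_inner_self_eq_norm_sq,
      hSsymm v v]
  have hwS : ‖w‖ ≤ 1 / 2 * ‖S v‖ := calc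
    ‖w‖ ≤ ε * (C * ‖S v‖) := hw.trans (mul_le_mul_of_nonneg_left (hSC v) hε)
    _ = ε * C * ‖S v‖ := by ring
    _ ≤ _ := mul_le_mul_of_nonneg_right hεC (norm_nonneg _)
  have herr : -(1 / 2 * ‖S v‖ ^ 2) ≤ ⟪S v, w⟫ := by
    have h1 := neg_le_of_abs_le (abs_real_inner_le_norm (S v) w)
    nlinarith [mul_le_mul_of_nonneg_left hwS (norm_nonneg (S v))]
  have hzn : ‖z‖ ≤ (‖H‖ + ε) * C * ‖S v‖ := calc
    ‖z‖ ≤ ‖H v‖ + ‖w‖ := norm_add_le _ _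
    _ ≤ ‖H‖ * ‖v‖ + ε * ‖v‖ := add_le_add (H.le_opNorm v) hw
    _ = (‖H‖ + ε) * ‖v‖ := by ring
    _ ≤ (‖H‖ + ε) * (C * ‖S v‖) := mul_le_mul_of_nonneg_left (hSC v) (by positivity)
    _ = _ := by ring
  have hquad : -(‖S‖ * ((‖H‖ + ε) * C) ^ 2 * ‖S v‖ ^ 2) ≤ ⟪z, S z⟫ := by
    have h1 := neg_le_of_abs_le (abs_real_inner_le_norm z (S z))
    have h2 : ‖z‖ * ‖S z‖ ≤ ‖S‖ * ‖z‖ ^ 2 := by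
      nlinarith [mul_le_mul_of_nonneg_left (S.le_opNorm z) (norm_nonneg z)]
    have h3 : ‖S‖ * ‖z‖ ^ 2 ≤ ‖S‖ * ((‖H‖ + ε) * C * ‖S v‖) ^ 2 := by gcongr
    nlinarith
  have h4 := mul_le_mul_of_nonneg_left hquad (sq_nonneg a)
  have h5 : a * (a * (‖S‖ * ((‖H‖ + ε) * C) ^ 2)) * ‖S v‖ ^ 2 ≤ a * 1 * ‖S v‖ ^ 2 := by gcongr
  have h6 := mul_le_mul_of_nonneg_left herr ha
  rw [hexp, hlin]
  nlinarith

/-- An operator with a negative eigenvalue has an injective shift `H + δ`, `δ > 0`,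
whose quadratic form still takes negative values. -/
theorem exists_antilipschitz_shift [FiniteDimensional ℝ E] {H : E →L[ℝ] E} {μ : ℝ} (hμ : μ < 0)
    (hHμ : Module.End.HasEigenvalue H.toLinearMap μ) :
    ∃ (δ : ℝ) (S : E →L[ℝ] E) (C : ℝ) (e : E), 0 < δ ∧ (∀ v, S v = H v + δ • v) ∧ 0 < C ∧
      (∀ v, ‖v‖ ≤ C * ‖S v‖) ∧ ⟪e, S e⟫ < 0 := by
  -- Only finitely many points of `(μ, 0)` are eigenvalues; any other `ν` gives an injective `H -
  -- ν`, negative on the `μ`-eigenvector.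
  obtain ⟨ν, ⟨hμν, hν0⟩, hν⟩ := ((Set.Ioo_infinite hμ).sdiff
    (Module.End.finite_hasEigenvalue H.toLinearMap)).nonempty
  obtain ⟨e, he⟩ := hHμ.exists_hasEigenvector
  let S : E →L[ℝ] E := H + (-ν) • ContinuousLinearMap.id ℝ E
  have hS : ∀ v, S v = H v + (-ν) • v := fun v => by simp [S]
  have hker : LinearMap.ker S.toLinearMap = ⊥ := by
    refine (Submodule.eq_bot_iff _).2 fun v hv => by_contra fun hv0 => hν ?_
    refine Module.End.hasEigenvalue_of_hasEigenvector (x := v) ⟨?_, hv0⟩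
    have : H v + (-ν) • v = 0 := by rw [← hS]; exact hv
    rw [Module.End.mem_eigenspace_iff]
    simpa [add_neg_eq_zero] using this
  obtain ⟨K, hK, hanti⟩ := LinearMap.exists_antilipschitzWith S.toLinearMap hker
  refine ⟨-ν, S, K, e, by linarith, hS, hK, fun v => ?_, ?_⟩
  · simpa using hanti.le_mul_dist v 0
  · have hHe : H e = μ • e := he.apply_eq_smul
    have : 0 < ‖e‖ := norm_pos_iff.2 he.2
    rw [hS, hHe, ← add_smul, inner_smul_right, real_inner_self_eq_norm_sq]
    exact mul_neg_of_neg_of_pos (by linarith) (by positivity)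

/-- A set is null if the differences of its points avoid the negative cone of a quadratic form. -/
theorem addHaar_eq_zero_of_inner_sub_nonneg [FiniteDimensional ℝ E] [MeasurableSpace E]
    [BorelSpace E] (ν : Measure E) [ν.IsAddHaarMeasure] {S : E →L[ℝ] E} {e : E}
    (he : ⟪e, S e⟫ < 0) {W : Set E} (hW : ∀ x ∈ W, ∀ y ∈ W, 0 ≤ ⟪x - y, S (x - y)⟫) :
    ν W = 0 := by
  -- The condition is closed, so it passes to the closure, which is measurable.
  have hcl : ∀ x ∈ closure W, ∀ y ∈ closure W, 0 ≤ ⟪x - y, S (x - y)⟫ := by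
    have hclosed : IsClosed {q : E × E | 0 ≤ ⟪q.1 - q.2, S (q.1 - q.2)⟫} :=
      isClosed_le continuous_const (by fun_prop)
    have hsub : closure (W ×ˢ W) ⊆ {q : E × E | 0 ≤ ⟪q.1 - q.2, S (q.1 - q.2)⟫} :=
      closure_minimal (fun q hq => hW q.1 hq.1 q.2 hq.2) hclosed
    intro x hx y hy
    exact hsub (by rw [closure_prod_eq]; exact ⟨hx, hy⟩ : (x, y) ∈ closure (W ×ˢ W))
  refine measure_mono_null subset_closure ?_
  -- Infinitely many bounded translates along `e` are disjoint: a common point would give a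
  -- difference that is a nonzero multiple of `e`.
  let t : ℕ → ℝ := fun n => 1 / ((n : ℝ) + 1)
  have ht : Function.Injective t := fun m n hmn => by
    have : ((m : ℝ) + 1) = n + 1 := by simpa [t] using hmn
    exact_mod_cast add_right_cancel this
  refine Measure.addHaar_eq_zero_of_disjoint_translates ν (fun n => t n • e) ?_ ?_
    isClosed_closure.measurableSet
  · refine (Metric.isBounded_closedBall (x := (0 : E)) (r := ‖e‖)).subset ?_
    rintro _ ⟨n, rfl⟩
    have h1 : |t n| ≤ 1 := by
      rw [abs_of_nonneg (by positivity)]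
      exact (div_le_one (by positivity)).2 (by simp)
    simpa [norm_smul] using mul_le_mul_of_nonneg_right h1 (norm_nonneg e)
  · intro m n hmn
    refine Set.disjoint_left.2 ?_
    rintro z hz1 hz2
    simp only [Set.singleton_add, Set.mem_image] at hz1 hz2
    obtain ⟨x, hx, rfl⟩ := hz1
    obtain ⟨y, hy, hxy⟩ := hz2
    have hd : x - y = (t n - t m) • e := by
      rw [sub_smul, sub_eq_sub_iff_add_eq_add, add_comm x, ← hxy]
    have h0 := hcl x hx y hy
    rw [hd, map_smul, inner_smul_left, inner_smul_right, conj_trivial, ← mul_assoc] at h0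
    have : 0 < (t n - t m) * (t n - t m) :=
      mul_self_pos.2 (sub_ne_zero.2 fun h => hmn (ht h).symm)
    exact absurd h0 (not_le.2 (mul_neg_of_pos_of_neg this he))

/-- The growth rates of a bounded sequence growing at least by factors `1 + b k` are summable. -/
theorem summable_of_growth {b q : ℕ → ℝ} {M : ℝ} (hb : ∀ k, 0 ≤ b k) (hq0 : 0 < q 0)
    (hq : ∀ k, (1 + b k) * q k ≤ q (k + 1)) (hM : ∀ k, q k ≤ M) : Summable b := by
  have hmono : ∀ k, q 0 ≤ q k := fun k => by
    induction k with
    | zero => exact le_rfl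
    | succ k ih => nlinarith [hq k, hb k, mul_nonneg (hb k) (hq0.le.trans ih)]
  refine summable_of_sum_range_le (c := (M - q 0) / q 0) hb fun n => ?_
  rw [le_div_iff₀ hq0]
  have : (∑ i ∈ Finset.range n, b i) * q 0 ≤ q n - q 0 := by
    induction n with
    | zero => simp
    | succ n ih =>
      rw [Finset.sum_range_succ]
      nlinarith [hq n, mul_le_mul_of_nonneg_left (hmono n) (hb n)]
  linarith [hM n]

/-- Near a point where the derivative of `G` is self-adjoint with a negative eigenvalue, the
starting points of the late orbits of `x k = x (k + 1) + α k • G (x (k + 1))` that stay in a small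
neighborhood form a null set. -/
theorem exists_nhds_forall_null_implicit_orbits [FiniteDimensional ℝ E] [MeasurableSpace E]
    [BorelSpace E] (ν : Measure E) [ν.IsAddHaarMeasure] {G : E → E} {H : E →L[ℝ] E} {p : E}
    (hG : HasStrictFDerivAt G H p) (hH : ∀ v w, ⟪H v, w⟫ = ⟪v, H w⟫) {μ : ℝ} (hμ : μ < 0)
    (hHμ : Module.End.HasEigenvalue H.toLinearMap μ) {α : ℕ → ℝ} (hα_pos : ∀ k, 0 < α k)
    (hα_lim : Tendsto α atTop (𝓝 0)) (hα_sum : ¬ Summable α) :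
    ∃ U ∈ 𝓝 p, ∀ᶠ K in atTop, ν {y | ∃ x : ℕ → E, x 0 = y ∧ (∀ k, x k ∈ U) ∧
      ∀ k, x k = x (k + 1) + α (K + k) • G (x (k + 1))} = 0 := by
  obtain ⟨δ, S, C, e, hδ, hS, hC, hSC, he⟩ := exists_antilipschitz_shift hμ hHμ
  set ε : ℝ := 1 / (2 * C) with hεdef
  have hε : 0 < ε := by positivity
  have hεC : ε * C ≤ 1 / 2 := by rw [hεdef]; field_simp; exact le_rfl
  have hnhds := hG.isLittleO.def hε
  rw [nhds_prod_eq] at hnhds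
  obtain ⟨U, hU, hUG⟩ := eventually_prod_self_iff'.1 hnhds
  refine ⟨U ∩ Metric.ball p 1, inter_mem hU (Metric.ball_mem_nhds p one_pos), ?_⟩
  have hsmall : ∀ c d : ℝ, 0 < d → ∀ᶠ k in atTop, α k * c < d := fun c d hd =>
    (by simpa using hα_lim.mul_const c : Tendsto (fun k => α k * c) atTop (𝓝 0)).eventually
      (gt_mem_nhds hd)
  obtain ⟨K₀, hK₀⟩ := eventually_atTop.1 <|
    (hsmall (‖S‖ * ((‖H‖ + ε) * C) ^ 2) 1 one_pos).and (hsmall (2 * δ) 1 one_pos)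
  filter_upwards [eventually_ge_atTop K₀] with K hK
  refine addHaar_eq_zero_of_inner_sub_nonneg ν he ?_
  rintro _ ⟨x, rfl, hxU, hx⟩ _ ⟨y, rfl, hyU, hy⟩
  by_contra! hneg
  let q : ℕ → ℝ := fun k => -⟪x k - y k, S (x k - y k)⟫
  have hstep : ∀ k, q k ≤ (1 - 2 * α (K + k) * δ) * q (k + 1) := fun k => by
    have h := inner_shift_expansion hH hS hSC hε.le hεC (hα_pos (K + k)).le
      (hK₀ (K + k) (by omega)).1.le (u := x k - y k) (v := x (k + 1) - y (k + 1))
      (hUG _ (hxU (k + 1)).1 _ (hyU (k + 1)).1) (by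
        rw [hx k, hy k]; simp only [smul_add, smul_sub]; abel)
    simp only [q]; linarith
  have hpos : ∀ k, 0 < q k := fun k => by
    induction k with
    | zero => exact neg_pos.2 hneg
    | succ k ih =>
      have h1 := (hK₀ (K + k) (by omega)).2
      exact pos_of_mul_pos_right (ih.trans_le (hstep k)) (by linarith)
  -- With `s = 2 * δ * α (K + k)`, this uses `(1 + s) * (1 - s) ≤ 1`.
  have hgrow : ∀ k, (1 + 2 * δ * α (K + k)) * q k ≤ q (k + 1) := fun k => by
    have h1 := mul_le_mul_of_nonneg_left (hstep k)
      (by have := hα_pos (K + k); positivity : 0 ≤ 1 + 2 * δ * α (K + k))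
    nlinarith [mul_nonneg (sq_nonneg (2 * δ * α (K + k))) (hpos (k + 1)).le]
  have hbdd : ∀ k, q k ≤ ‖S‖ * 2 ^ 2 := fun k => by
    have h1 : ‖x k - y k‖ ≤ 2 := by
      rw [← dist_eq_norm]
      linarith [dist_triangle_right (x k) (y k) p, Metric.mem_ball.1 (hxU k).2,
        Metric.mem_ball.1 (hyU k).2]
    have h2 := neg_le_of_abs_le (abs_real_inner_le_norm (x k - y k) (S (x k - y k)))
    have h3 := mul_le_mul_of_nonneg_left (S.le_opNorm (x k - y k)) (norm_nonneg (x k - y k))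
    have h4 : ‖S‖ * ‖x k - y k‖ ^ 2 ≤ ‖S‖ * 2 ^ 2 := by gcongr
    simp only [q]; nlinarith
  have hsum : Summable fun k => 2 * δ * α (K + k) := summable_of_growth
    (fun k => by have := hα_pos (K + k); positivity) (hpos 0) hgrow hbdd
  have h2 : Summable fun k => α (K + k) := (summable_mul_left_iff (by positivity)).1 hsum
  simp only [add_comm K] at h2
  exact hα_sum ((summable_nat_add_iff K).1 h2)

/-- Null sets pull back to null sets along finitely many implicit steps. -/
theorem null_implicit_orbits_of_null [FiniteDimensional ℝ E] [MeasurableSpace E]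
    [BorelSpace E] (ν : Measure E) [ν.IsAddHaarMeasure] {X : Set E} {g : ℕ → E → E}
    (hg : ∀ k, DifferentiableOn ℝ (g k) X) (n : ℕ) {A : Set E} (hA : ν A = 0) :
    ν {y | ∃ x : ℕ → E, x 0 = y ∧ (∀ k, x k ∈ X) ∧ (∀ k, x k = g k (x (k + 1))) ∧ x n ∈ A} = 0 := by
  induction n generalizing A with
  | zero => exact measure_mono_null (by rintro _ ⟨x, rfl, -, -, h⟩; exact h) hA
  | succ n ih =>
    refine measure_mono_null ?_ (ih (A := g n '' (A ∩ X)) ?_)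
    · rintro _ ⟨x, rfl, hX, hx, h⟩
      exact ⟨x, rfl, hX, hx, x (n + 1), ⟨h, hX _⟩, (hx n).symm⟩
    · exact addHaar_image_eq_zero_of_differentiableOn_of_addHaar_eq_zero ν
        ((hg n).mono Set.inter_subset_right) (measure_mono_null Set.inter_subset_left hA)

end NormedSpace

section Euclidean

variable {d : ℕ} {f : EuclideanSpace ℝ (Fin d) → ℝ} {X : Set (EuclideanSpace ℝ (Fin d))}

theorem ContDiffOn.gradient_of_isOpen (hX : IsOpen X) (hf : ContDiffOn ℝ 2 f X) :
    ContDiffOn ℝ 1 (gradient f) X :=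
  (InnerProductSpace.toDual ℝ (EuclideanSpace ℝ (Fin d))).symm.contDiff.comp_contDiffOn
    (hf.fderiv_of_isOpen hX (by norm_num))

theorem inner_gradient_eq_fderiv (x w : EuclideanSpace ℝ (Fin d)) :
    ⟪gradient f x, w⟫ = fderiv ℝ f x w :=
  InnerProductSpace.toDual_symm_apply

theorem inner_hessian_left (hX : IsOpen X) (hf : ContDiffOn ℝ 2 f X)
    {p : EuclideanSpace ℝ (Fin d)} (hp : p ∈ X) (v w : EuclideanSpace ℝ (Fin d)) :
    ⟪hessian f p v, w⟫ = fderiv ℝ (fderiv ℝ f) p v w := by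
  have hd : DifferentiableAt ℝ (gradient f) p :=
    ((hf.gradient_of_isOpen hX).contDiffAt (hX.mem_nhds hp)).differentiableAt one_ne_zero
  have hdd : DifferentiableAt ℝ (fderiv ℝ f) p :=
    ((hf.fderiv_of_isOpen (m := 1) hX (by norm_num)).contDiffAt
      (hX.mem_nhds hp)).differentiableAt one_ne_zero
  have h1 := hd.hasFDerivAt.inner ℝ (hasFDerivAt_const w p)
  simp only [inner_gradient_eq_fderiv] at h1
  have h := DFunLike.congr_fun (h1.unique (hdd.hasFDerivAt.clm_apply (hasFDerivAt_const w p))) v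
  simpa [hessian] using h

theorem inner_hessian_comm (hX : IsOpen X) (hf : ContDiffOn ℝ 2 f X)
    {p : EuclideanSpace ℝ (Fin d)} (hp : p ∈ X) (v w : EuclideanSpace ℝ (Fin d)) :
    ⟪hessian f p v, w⟫ = ⟪v, hessian f p w⟫ := by
  rw [real_inner_comm (hessian f p w) v, inner_hessian_left hX hf hp,
    inner_hessian_left hX hf hp]
  exact (hf.contDiffAt (hX.mem_nhds hp)).isSymmSndFDerivAt (by simp) v w

/-- As `X` is open, the minimizer is interior and the objective's derivative vanishes there. -/
theorem eq_add_smul_gradient_of_mem_proxArgmin (hX : IsOpen X) (hf : ContDiffOn ℝ 2 f X) {a : ℝ}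
    (ha : 0 < a) {x y : EuclideanSpace ℝ (Fin d)} (hy : y ∈ proxArgmin f X a x) :
    x = y + a • gradient f y := by
  have hfy : HasFDerivAt f (fderiv ℝ f y) y :=
    ((hf.contDiffAt (hX.mem_nhds hy.1)).differentiableAt two_ne_zero).hasFDerivAt
  have hmin := (hy.2.isLocalMin (hX.mem_nhds hy.1)).hasFDerivAt_eq_zero
    (hfy.add ((((hasFDerivAt_id y).const_sub x).norm_sq).const_mul (1 / (2 * a))))
  have h : ∀ v, ⟪a • gradient f y - (x - y), v⟫ = 0 := fun v => by
    have h1 := DFunLike.congr_fun hmin v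
    simp only [add_apply, smul_apply,
      ContinuousLinearMap.comp_apply, neg_apply, ContinuousLinearMap.id_apply,
      zero_apply, innerSL_apply_apply, inner_neg_right, smul_eq_mul,
      nsmul_eq_mul, id, ← inner_gradient_eq_fderiv] at h1
    rw [inner_sub_left, inner_smul_left, conj_trivial]
    field_simp at h1
    push_cast at h1
    linarith
  have := inner_self_eq_zero.1 (h _)
  rw [sub_eq_zero] at this
  rw [this]; abel

end Euclidean

theorem theorem5p3 (d : ℕ) (X : Set (EuclideanSpace ℝ (Fin d))) (hX : IsOpen X)
    (hXc : Convex ℝ X) (f : EuclideanSpace ℝ (Fin d) → ℝ) (hf : ContDiffOn ℝ 2 f X)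
    (α : ℕ → ℝ) (hα_pos : ∀ k, 0 < α k) (hα_lim : Tendsto α atTop (𝓝 0))
    (hα_omega : (fun k : ℕ => 1 / (k : ℝ)) =O[atTop] α) :
    volume (proximalStableSet f X α (strictSaddles f X)) = 0 := by
  have hα_sum : ¬ Summable α := fun h =>
    Real.not_summable_one_div_natCast (summable_of_isBigO_nat h hα_omega)
  have hlocal : ∀ p : EuclideanSpace ℝ (Fin d), ∃ U ∈ 𝓝 p, p ∈ strictSaddles f X →
      ∀ᶠ K in atTop, volume {y | ∃ x : ℕ → EuclideanSpace ℝ (Fin d), x 0 = y ∧ (∀ k, x k ∈ U) ∧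
        ∀ k, x k = x (k + 1) + α (K + k) • gradient f (x (k + 1))} = 0 := fun p => by
    by_cases hp : p ∈ strictSaddles f X
    · obtain ⟨hpX, -, μ, hμ, hHμ⟩ := hp
      obtain ⟨U, hU, h⟩ := exists_nhds_forall_null_implicit_orbits volume
        (((hf.gradient_of_isOpen hX).contDiffAt (hX.mem_nhds hpX)).hasStrictFDerivAt one_ne_zero)
        (inner_hessian_comm hX hf hpX) hμ hHμ hα_pos hα_lim hα_sum
      exact ⟨U, hU, fun _ => h⟩
    · exact ⟨Set.univ, univ_mem, fun h => absurd h hp⟩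
  choose U hU hnull using hlocal
  -- Saddles need not be isolated or countable; the Lindelöf property reduces to countably many
  -- neighborhoods.
  obtain ⟨T, hTA, hT, hcover⟩ := TopologicalSpace.countable_cover_nhdsWithin
    (s := strictSaddles f X) (f := fun p => interior (U p))
    fun p _ => mem_nhdsWithin_of_mem_nhds (interior_mem_nhds.2 (hU p))
  have hgd : ∀ k, DifferentiableOn ℝ (fun y => y + α k • gradient f y) X := fun k =>
    differentiableOn_id.add
      (((hf.gradient_of_isOpen hX).differentiableOn one_ne_zero).const_smul (α k))
  let W : EuclideanSpace ℝ (Fin d) → ℕ → Set (EuclideanSpace ℝ (Fin d)) := fun p K =>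
    {y | ∃ x : ℕ → EuclideanSpace ℝ (Fin d), x 0 = y ∧ (∀ k, x k ∈ U p) ∧
        ∀ k, x k = x (k + 1) + α (K + k) • gradient f (x (k + 1))}
  have hbig : ∀ p ∈ T, volume (⋃ K ∈ {K | volume (W p K) = 0},
      {y | ∃ x : ℕ → EuclideanSpace ℝ (Fin d), x 0 = y ∧ (∀ k, x k ∈ X) ∧
        (∀ k, x k = x (k + 1) + α k • gradient f (x (k + 1))) ∧ x K ∈ W p K}) = 0 := fun p _ =>
    (measure_biUnion_null_iff (Set.to_countable _)).2 fun K hK =>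
      null_implicit_orbits_of_null volume hgd K hK
  refine measure_mono_null ?_ ((measure_biUnion_null_iff hT).2 hbig)
  rintro _ ⟨x, rfl, ⟨hx0, hx⟩, p, hp, hlim⟩
  have hxX : ∀ k, x k ∈ X := fun k => by
    cases k with
    | zero => exact hx0
    | succ k => exact (hx k).1
  have hxg : ∀ k, x k = x (k + 1) + α k • gradient f (x (k + 1)) := fun k =>
    eq_add_smul_gradient_of_mem_proxArgmin hX hf (hα_pos k) (hx k)
  obtain ⟨p', hp', hpU⟩ := Set.mem_iUnion₂.1 (hcover hp)
  obtain ⟨N, hN⟩ := eventually_atTop.1 (hlim.eventually (isOpen_interior.mem_nhds hpU))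
  -- `K` is late enough both for the null set at `p'` and for the orbit to have settled in `U p'`.
  obtain ⟨K, hK, hNK⟩ := ((hnull p' (hTA hp')).and (eventually_ge_atTop N)).exists
  refine Set.mem_iUnion₂.2 ⟨p', hp', Set.mem_iUnion₂.2 ⟨K, hK, x, rfl, hxX, hxg, ?_⟩⟩
  exact ⟨fun k => x (K + k), rfl, fun k => interior_subset (hN (K + k) (by omega)),
    fun k => hxg (K + k)⟩
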